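/- Let $\mathbb C_+=\{z\in\mathbb C:\operatorname{Im}z>0\}$ and let $\overline{\mathbb R}=\mathbb R\sqcup\{\infty\}$ be its boundary in the Riemann sphere (a circle). For $z\in\mathbb C_+$ put $\phi_s(z)=\frac{1+sz}{s-z}$ for $s\in\mathbb R$ and $\phi_\infty(z)=z$. An \emph{endofunction} is a holomorphic map $\varphi:\mathbb C_+\to\mathbb C_+$; a \emph{representing measure} of $\varphi$ is a finite positive Borel measure $\lambda$ on $\overline{\mathbb R}$ with \[ \varphi(z)=\operatorname{Re}\varphi(i)+\int_{\overline{\mathbb R}}\phi_s(z)\,\lambda(ds)\qquad(z\in\mathbb C_+). \] For an invertible complex matrix $M=\begin{pmatrix}a&b\\c&d\end{pmatrix}$ write $\phi_M(z)=M.z=\frac{az+b}{cz+d}$; $M$ is an \emph{endomatrix} if $M.z\in\mathbb C_+$ for all $z\in\mathbb C_+$. Put ${}_sM=\frac1{\sqrt{1+s^2}}\begin{pmatrix}s&1\\-1&s\end{pmatrix}M$ for $s\in\mathbb R$ and ${}_\infty M=M$. \textbf{Theorem.} Let $M$ be an endomatrix and let $\varphi$ be an endofunction with representing measure $\lambda$.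 Then: (1) For every $s\in\overline{\mathbb R}$, $\phi_{{}_sM}$ is an endofunction and has a unique representing measure, denoted $\mu_{{}_sM}$. (2) For every continuous $f:\overline{\mathbb R}\to\mathbb C$ the function $s\mapsto\int f\,d\mu_{{}_sM}$ is continuous on $\overline{\mathbb R}$, and the mixture $\lambda^M=\int_{\overline{\mathbb R}}\lambda(ds)\,\mu_{{}_sM}$ satisfies \[ \int_{\overline{\mathbb R}}f(t)\,\lambda^M(dt)=\int_{\overline{\mathbb R}}\lambda(ds)\int_{\overline{\mathbb R}}f(t)\,\mu_{{}_sM}(dt). \] (3) For all $z\in\mathbb C_+$, \[ \varphi(M.z)=\operatorname{Re}\varphi(i)+\int_{\overline{\mathbb R}}\operatorname{Re}\phi_s(M.i)\,\lambda(ds)+\int_{\overline{\mathbb R}}\phi_t(z)\,\lambda^M(dt). \] (4) In other words, $\operatorname{Re}\varphi(M.i)=\operatorname{Re}\varphi(i)+\int_{\overline{\mathbb R}}\operatorname{Re}\phi_s(M.i)\,\lambda(ds)$, and $z\mapsto\varphi(M.z)$ is an endofunction whose unique representing measure is $\lambda^M$. -/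

import Mathlib

open MeasureTheory UpperHalfPlane

namespace MobiusEndo

/-- The boundary `OnePoint ℝ = ℝ ∪ {∞}` of the upper half plane in the Riemann sphere
carries its Borel σ-algebra. -/
instance instMeasurableSpaceBoundary : MeasurableSpace (OnePoint ℝ) := borel (OnePoint ℝ)

instance instBorelSpaceBoundary : BorelSpace (OnePoint ℝ) := ⟨rfl⟩

/-- An endofunction: a holomorphic map of the upper half plane into itself
(the values of `φ` off the upper half plane are irrelevant). -/
structure IsEndofunction (φ : ℂ → ℂ) : Prop where
  holomorphic : DifferentiableOn ℂ φ upperHalfPlaneSet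
  mapsTo : Set.MapsTo φ upperHalfPlaneSet upperHalfPlaneSet

/-- The linear fractional function `M.z = (a z + b) / (c z + d)` of a matrix
`M = !![a, b; c, d]`. -/
noncomputable def mobius (M : Matrix (Fin 2) (Fin 2) ℂ) (z : ℂ) : ℂ :=
  (M 0 0 * z + M 0 1) / (M 1 0 * z + M 1 1)

/-- An endomatrix: an invertible complex matrix whose Möbius transform maps the upper half plane
into itself. (A point `z` with `c z + d = 0`, which is sent to `∞` on the Riemann sphere, gets
the value `0` from `mobius`, which is not in the upper half plane either; so the
condition correctly excludes poles in the upper half plane.) -/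
structure IsEndomatrix (M : Matrix (Fin 2) (Fin 2) ℂ) : Prop where
  det_ne_zero : M.det ≠ 0
  mapsTo : Set.MapsTo (mobius M) upperHalfPlaneSet upperHalfPlaneSet

/-- The atomic endofunction `φ_s(z) = (1 + s z) / (s - z)` for real `s`, and `φ_∞(z) = z`. -/
noncomputable def atomic (s : OnePoint ℝ) (z : ℂ) : ℂ :=
  s.elim z (fun x : ℝ => (1 + (x : ℂ) * z) / ((x : ℂ) - z))

/-- `ν` is a representing measure of `φ`: a finite positive Borel measure on `ℝ ∪ {∞}`
with `φ(z) = Re φ(i) + ∫ φ_s(z) ν(ds)` on the upper half plane. (The space is compact and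
metrizable, so finite Borel measures are the positive Radon measures; the integrand
is continuous in `s`, hence integrable.) -/
structure IsReprMeasure (φ : ℂ → ℂ) (ν : Measure (OnePoint ℝ)) : Prop where
  finite : IsFiniteMeasure ν
  repr : ∀ z ∈ upperHalfPlaneSet, φ z = ((φ Complex.I).re : ℂ) + ∫ s, atomic s z ∂ν

open Classical in
/-- The representing measure of `φ` (zero if there is none). -/
noncomputable def reprMeasure (φ : ℂ → ℂ) : Measure (OnePoint ℝ) :=
  if h : ∃ ν : Measure (OnePoint ℝ), IsReprMeasure φ ν then h.choose else 0

/-- The left translate `ₛM = (1 + s²)^(-1/2) !![s, 1; -1, s] * M` for real `s`,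
with the limit `M` at `s = ∞`. -/
noncomputable def leftTranslate (s : OnePoint ℝ) (M : Matrix (Fin 2) (Fin 2) ℂ) :
    Matrix (Fin 2) (Fin 2) ℂ :=
  s.elim M (fun x : ℝ =>
    (((Real.sqrt (1 + x ^ 2))⁻¹ : ℝ) : ℂ) • (!![(x : ℂ), 1; -1, (x : ℂ)] * M))

/-- The representing measure of the Möbius endofunction of the left translate `ₛM`. -/
noncomputable def translateMeasure (M : Matrix (Fin 2) (Fin 2) ℂ) (s : OnePoint ℝ) :
    Measure (OnePoint ℝ) :=
  reprMeasure (mobius (leftTranslate s M))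

/-- The mixture `ν^M = ∫ ν(ds) μ_{ₛM}` of the representing measures of the left translates. -/
noncomputable def mixture (ν : Measure (OnePoint ℝ)) (M : Matrix (Fin 2) (Fin 2) ℂ) :
    Measure (OnePoint ℝ) :=
  ν.bind (translateMeasure M)

end MobiusEndo

/-!
Every endofunction `φ` has exactly one representing measure (Nevanlinna's representation), and the
statement about mixtures follows by integrating the representations of the left translates.

*Uniqueness and weak continuity.* The atomic functions `s ↦ φ_s(z)`, for `z` in either open half
plane, satisfy the cotangent addition formula (`atomic_mul_atomic`), so a product of two of them
at distinct points is a combination of the same two and a constant, and a square is a limit of such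
products. Hence their closed span is a star algebra, which by
Stone–Weierstrass is all of `C(ℝ ∪ {∞})` (`dense_span_atomicMap`). A finite measure is thus
determined by the integrals of the atomic functions, and weak continuity of a family of measures
with bounded masses need be checked only on them.

*Existence.* In the coordinates `ζ = (s - i) / (s + i)` and `w = (z - i) / (z + i)` the atomic
function is `i` times the Herglotz kernel `(ζ + w) / (ζ - w)`. A function that is holomorphic in the
disk and continuous up to the circle has its boundary imaginary part as density
(`exists_measure_of_diffContOnCl`). A general endofunction is the limit of its dilates, whose
measures all have mass `Im φ(i)`; any cluster point of these, which exists by compactness,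
represents `φ` (`IsEndofunction.exists_isReprMeasure`).

*Mixtures.* The left translate `ₛM` has the linear fractional function `φ_s ∘ M`, so
`φ_s(M.z) = Re φ_s(M.i) + ∫ φ_t(z) μ_{ₛM}(dt)`. The integrals `∫ φ_t(z) μ_{ₛM}(dt)` are therefore
continuous in `s`, the family `s ↦ μ_{ₛM}` is weakly continuous and measurable, and integration over
`ν(ds)` gives the representation of `φ ∘ M` (`IsEndomatrix.repr_comp_mobius`).
-/

namespace MobiusEndo

open Filter Topology

/-! ### The circle coordinate and the atomic endofunctions -/

/-- The Cayley coordinate `(s - i) / (s + i)` of a boundary point, with value `1` at `∞`; it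
identifies the boundary with the unit circle. -/
noncomputable def circleCoord (s : OnePoint ℝ) : ℂ :=
  s.elim 1 (fun x : ℝ => ((x : ℂ) - Complex.I) / ((x : ℂ) + Complex.I))

lemma ofReal_sub_ne_zero {z : ℂ} (hz : z.im ≠ 0) (x : ℝ) : (x : ℂ) - z ≠ 0 := by
  intro h
  apply hz
  have := congrArg Complex.im h
  simpa using this

lemma ofReal_add_I_ne_zero (x : ℝ) : (x : ℂ) + Complex.I ≠ 0 := by
  intro h
  simpa using congrArg Complex.im h

lemma continuous_circleCoord : Continuous circleCoord := by
  have key : ∀ x : ℝ, ((x : ℂ) - Complex.I) / ((x : ℂ) + Complex.I)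
      = 1 - 2 * Complex.I * ((x : ℂ) + Complex.I)⁻¹ := fun x => by
    have := ofReal_add_I_ne_zero x
    field_simp
    ring
  rw [OnePoint.continuous_iff]
  constructor
  · change Tendsto (fun x : ℝ => ((x : ℂ) - Complex.I) / ((x : ℂ) + Complex.I)) _ (𝓝 1)
    simp_rw [key]
    have h1 : Tendsto (fun x : ℝ => (x : ℂ) + Complex.I) (coclosedCompact ℝ)
        (Bornology.cobounded ℂ) := by
      rw [coclosedCompact_eq_cocompact, Metric.cobounded_eq_cocompact]
      exact (Homeomorph.addRight Complex.I).isClosedEmbedding.tendsto_cocompact.comp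
        Complex.isometry_ofReal.isClosedEmbedding.tendsto_cocompact
    have h2 := (tendsto_inv₀_cobounded.comp h1).const_mul (2 * Complex.I)
    simpa using h2.const_sub 1
  · change Continuous (fun x : ℝ => ((x : ℂ) - Complex.I) / ((x : ℂ) + Complex.I))
    exact Continuous.div (by fun_prop) (by fun_prop) ofReal_add_I_ne_zero

lemma norm_circleCoord (s : OnePoint ℝ) : ‖circleCoord s‖ = 1 := by
  induction s using OnePoint.rec with
  | infty => simp [circleCoord]
  | coe x =>
    have h : ‖(x : ℂ) - Complex.I‖ = ‖(x : ℂ) + Complex.I‖ := by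
      rw [← Complex.norm_conj]
      simp
    change ‖((x : ℂ) - Complex.I) / ((x : ℂ) + Complex.I)‖ = 1
    rw [norm_div, h, div_self (norm_ne_zero_iff.2 (ofReal_add_I_ne_zero x))]

lemma norm_sub_I_ne_norm_add_I {z : ℂ} (hz : z.im ≠ 0) :
    ‖z - Complex.I‖ ≠ ‖z + Complex.I‖ := by
  intro h
  apply hz
  have h2 : Complex.normSq (z - Complex.I) = Complex.normSq (z + Complex.I) := by
    rw [Complex.normSq_eq_norm_sq, Complex.normSq_eq_norm_sq, h]
  simp only [Complex.normSq_apply, Complex.sub_re, Complex.sub_im, Complex.add_re, Complex.add_im,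
    Complex.I_re, Complex.I_im] at h2
  linarith

lemma circleCoord_mul_sub_ne_zero {z : ℂ} (hz : z.im ≠ 0) (s : OnePoint ℝ) :
    circleCoord s * (z + Complex.I) - (z - Complex.I) ≠ 0 := by
  intro h
  apply norm_sub_I_ne_norm_add_I hz
  rw [← sub_eq_zero.1 h, norm_mul, norm_circleCoord, one_mul]

/-- In the circle coordinates `ζ` of `s` and `w = (z - i) / (z + i)` of `z`, the atomic
endofunction is `i` times the Herglotz kernel `(ζ + w) / (ζ - w)`. -/
lemma atomic_eq_circleCoord {z : ℂ} (hz : z.im ≠ 0) (s : OnePoint ℝ) :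
    atomic s z = Complex.I * (circleCoord s * (z + Complex.I) + (z - Complex.I)) /
      (circleCoord s * (z + Complex.I) - (z - Complex.I)) := by
  rw [eq_div_iff (circleCoord_mul_sub_ne_zero hz s)]
  induction s using OnePoint.rec with
  | infty =>
    change z * (1 * (z + Complex.I) - (z - Complex.I))
      = Complex.I * (1 * (z + Complex.I) + (z - Complex.I))
    ring
  | coe x =>
    change (1 + (x : ℂ) * z) / ((x : ℂ) - z) *
      (((x : ℂ) - Complex.I) / ((x : ℂ) + Complex.I) * (z + Complex.I) - (z - Complex.I))
      = Complex.I *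
        (((x : ℂ) - Complex.I) / ((x : ℂ) + Complex.I) * (z + Complex.I) + (z - Complex.I))
    have h1 := ofReal_sub_ne_zero hz x
    have h2 := ofReal_add_I_ne_zero x
    field_simp
    linear_combination 2 * Complex.I * ((x : ℂ) - z) * Complex.I_sq

lemma atomic_conj (s : OnePoint ℝ) (z : ℂ) :
    atomic s (starRingEnd ℂ z) = starRingEnd ℂ (atomic s z) := by
  induction s using OnePoint.rec with
  | infty => rfl
  | coe x => simp [atomic]

lemma atomic_I (s : OnePoint ℝ) : atomic s Complex.I = Complex.I := by
  induction s using OnePoint.rec with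
  | infty => rfl
  | coe x =>
    have : (x : ℂ) - Complex.I ≠ 0 := ofReal_sub_ne_zero (by simp) x
    change (1 + (x : ℂ) * Complex.I) / ((x : ℂ) - Complex.I) = Complex.I
    rw [div_eq_iff this]
    ring_nf
    simp only [Complex.I_sq]
    ring

/-- The addition formula of the cotangent: with `z = cot a`, `w = cot b` and `s = cot c` the two
factors are `cot (a - c)` and `cot (b - c)`. -/
lemma atomic_mul_atomic {z w : ℂ} (hz : z.im ≠ 0) (hw : w.im ≠ 0) (hzw : z ≠ w)
    (s : OnePoint ℝ) :
    atomic s z * atomic s w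
      = -1 + (1 + z * w) / (w - z) * atomic s w - (1 + z * w) / (w - z) * atomic s z := by
  have h0 : w - z ≠ 0 := sub_ne_zero.2 hzw.symm
  induction s using OnePoint.rec with
  | infty =>
    change z * w = -1 + (1 + z * w) / (w - z) * w - (1 + z * w) / (w - z) * z
    field_simp
    ring
  | coe x =>
    have h1 := ofReal_sub_ne_zero hz x
    have h2 := ofReal_sub_ne_zero hw x
    change (1 + (x : ℂ) * z) / ((x : ℂ) - z) * ((1 + (x : ℂ) * w) / ((x : ℂ) - w)) =
      -1 + (1 + z * w) / (w - z) * ((1 + (x : ℂ) * w) / ((x : ℂ) - w))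
        - (1 + z * w) / (w - z) * ((1 + (x : ℂ) * z) / ((x : ℂ) - z))
    field_simp
    ring

/-- `circleCoord` can be recovered from the values of an atomic function at any point other than
`±i`; the point `2i` is used. -/
lemma circleCoord_eq_of_atomic_eq {s t : OnePoint ℝ}
    (h : atomic s (2 * Complex.I) = atomic t (2 * Complex.I)) : circleCoord s = circleCoord t := by
  have h2 : (2 * Complex.I).im ≠ 0 := by simp
  rw [atomic_eq_circleCoord h2, atomic_eq_circleCoord h2,
    div_eq_div_iff (circleCoord_mul_sub_ne_zero h2 s) (circleCoord_mul_sub_ne_zero h2 t)] at h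
  have h3 : (6 * Complex.I) * (circleCoord s - circleCoord t) = 0 := by
    linear_combination h + 6 * Complex.I * (circleCoord s - circleCoord t) * Complex.I_sq
  simpa [sub_eq_zero] using h3

lemma circleCoord_injective : Function.Injective circleCoord := by
  have aux : ∀ x : ℝ, ((x : ℂ) - Complex.I) / ((x : ℂ) + Complex.I) ≠ 1 := fun x h => by
    rw [div_eq_one_iff_eq (ofReal_add_I_ne_zero x)] at h
    have := congrArg Complex.im h
    norm_num at this
  intro s t h
  induction s using OnePoint.rec with
  | infty =>
    induction t using OnePoint.rec with
    | infty => rfl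
    | coe y => exact absurd h.symm (aux y)
  | coe x =>
    induction t using OnePoint.rec with
    | infty => exact absurd h (aux x)
    | coe y =>
      change ((x : ℂ) - Complex.I) / ((x : ℂ) + Complex.I)
        = ((y : ℂ) - Complex.I) / ((y : ℂ) + Complex.I) at h
      rw [div_eq_div_iff (ofReal_add_I_ne_zero x) (ofReal_add_I_ne_zero y)] at h
      have h3 : (2 * Complex.I) * ((x : ℂ) - y) = 0 := by linear_combination h
      have h4 : (x : ℂ) = y := by simpa [sub_eq_zero] using h3
      rw [Complex.ofReal_injective h4]

/-- Metrizability makes indicators of closed sets limits of continuous functions, so that finite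
Borel measures are determined by integrals of continuous functions. -/
instance instMetrizableSpaceBoundary : TopologicalSpace.MetrizableSpace (OnePoint ℝ) :=
  (continuous_circleCoord.isClosedEmbedding circleCoord_injective).isEmbedding.metrizableSpace

/-! ### Density of the span of the atomic functions -/

lemma continuous_atomic_uncurry :
    Continuous (fun p : {z : ℂ // z.im ≠ 0} × OnePoint ℝ => atomic p.2 p.1) := by
  have h : (fun p : {z : ℂ // z.im ≠ 0} × OnePoint ℝ => atomic p.2 p.1) = fun p =>
      Complex.I * (circleCoord p.2 * (p.1 + Complex.I) + (p.1 - Complex.I)) /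
      (circleCoord p.2 * (p.1 + Complex.I) - (p.1 - Complex.I)) :=
    funext fun p => atomic_eq_circleCoord p.1.2 p.2
  rw [h]
  have := continuous_circleCoord
  exact Continuous.div (by fun_prop) (by fun_prop)
    fun p => circleCoord_mul_sub_ne_zero p.1.2 p.2

lemma continuous_atomic {z : ℂ} (hz : z.im ≠ 0) : Continuous (fun s => atomic s z) :=
  continuous_atomic_uncurry.comp (Continuous.prodMk_right (⟨z, hz⟩ : {z : ℂ // z.im ≠ 0}))

/-- The atomic functions `s ↦ φ_s(z)`, as a continuous family of continuous functions on the
boundary; `z` may lie in either half plane. -/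
noncomputable def atomicMap : C({z : ℂ // z.im ≠ 0}, C(OnePoint ℝ, ℂ)) :=
  ContinuousMap.curry ⟨_, continuous_atomic_uncurry⟩

@[simp] lemma atomicMap_apply (z : {z : ℂ // z.im ≠ 0}) (s : OnePoint ℝ) :
    atomicMap z s = atomic s z := rfl

/-- The closed linear span of the atomic functions. -/
noncomputable def atomicSpan : Submodule ℂ C(OnePoint ℝ, ℂ) :=
  (Submodule.span ℂ (Set.range atomicMap)).topologicalClosure

lemma atomicMap_mem_atomicSpan (z : {z : ℂ // z.im ≠ 0}) : atomicMap z ∈ atomicSpan :=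
  Submodule.le_topologicalClosure _ (Submodule.subset_span ⟨z, rfl⟩)

lemma one_mem_atomicSpan : (1 : C(OnePoint ℝ, ℂ)) ∈ atomicSpan := by
  have h : (1 : C(OnePoint ℝ, ℂ)) = (-Complex.I) • atomicMap ⟨Complex.I, by simp⟩ := by
    ext s
    simp [atomic_I]
  rw [h]
  exact Submodule.smul_mem _ _ (atomicMap_mem_atomicSpan _)

lemma atomicMap_mul_mem_atomicSpan_of_ne {z w : {z : ℂ // z.im ≠ 0}} (hzw : z ≠ w) :
    atomicMap z * atomicMap w ∈ atomicSpan := by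
  have h : atomicMap z * atomicMap w = -1 + ((1 + (z : ℂ) * w) / (w - z)) • atomicMap w
      - ((1 + (z : ℂ) * w) / (w - z)) • atomicMap z := by
    ext s
    simpa using atomic_mul_atomic z.2 w.2 (fun h => hzw (Subtype.ext h)) s
  rw [h]
  exact Submodule.sub_mem _ (Submodule.add_mem _ (Submodule.neg_mem _ one_mem_atomicSpan)
    (Submodule.smul_mem _ _ (atomicMap_mem_atomicSpan _)))
    (Submodule.smul_mem _ _ (atomicMap_mem_atomicSpan _))

/-- The square of an atomic function is the limit of products at two distinct points. -/
lemma atomicMap_mul_mem_atomicSpan (z w : {z : ℂ // z.im ≠ 0}) :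
    atomicMap z * atomicMap w ∈ atomicSpan := by
  rcases ne_or_eq z w with h | rfl
  · exact atomicMap_mul_mem_atomicSpan_of_ne h
  -- the points `z (1 + 1 / (n + 1))` tend to `z`, differ from it and stay off the real line
  have him : ∀ n : ℕ, ((z : ℂ) * ((1 + 1 / ((n : ℝ) + 1) : ℝ) : ℂ)).im ≠ 0 := fun n => by
    rw [Complex.im_mul_ofReal]
    exact mul_ne_zero z.2 (by positivity)
  let u : ℕ → {z : ℂ // z.im ≠ 0} := fun n => ⟨_, him n⟩
  have hu : Tendsto u atTop (𝓝 z) := by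
    rw [tendsto_subtype_rng]
    have h1 := (tendsto_one_div_add_atTop_nhds_zero_nat (𝕜 := ℝ)).const_add 1
    have h2 := ((Complex.continuous_ofReal.tendsto _).comp h1).const_mul (z : ℂ)
    simpa [u] using h2
  have hne : ∀ n, z ≠ u n := fun n h => by
    have h1 := congrArg Complex.im (congrArg Subtype.val h)
    change (z : ℂ).im = ((z : ℂ) * ((1 + 1 / ((n : ℝ) + 1) : ℝ) : ℂ)).im at h1
    rw [Complex.im_mul_ofReal] at h1
    have h2 : (z : ℂ).im * (1 / ((n : ℝ) + 1)) = 0 := by linarith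
    exact mul_ne_zero z.2 (by positivity) h2
  refine (Submodule.isClosed_topologicalClosure _).mem_of_tendsto
    (((atomicMap.continuous.tendsto z).comp hu).const_mul (atomicMap z))
    (Eventually.of_forall fun n => atomicMap_mul_mem_atomicSpan_of_ne (hne n))

lemma mul_mem_atomicSpan {f g : C(OnePoint ℝ, ℂ)} (hf : f ∈ atomicSpan) (hg : g ∈ atomicSpan) :
    f * g ∈ atomicSpan := by
  refine Submodule.isClosed_topologicalClosure _ |>.closure_subset
    (map_mem_closure₂ continuous_mul hf hg fun a ha b hb => ?_)
  refine Submodule.span_induction₂ (p := fun a b _ _ => a * b ∈ atomicSpan) ?_ ?_ ?_ ?_ ?_ ?_ ?_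
    ha hb
  · rintro _ _ ⟨z, rfl⟩ ⟨w, rfl⟩
    exact atomicMap_mul_mem_atomicSpan z w
  · intro y _
    simp
  · intro x _
    simp
  · intro x y z _ _ _ hx hy
    rw [add_mul]
    exact add_mem hx hy
  · intro x y z _ _ _ hx hy
    rw [mul_add]
    exact add_mem hx hy
  · intro r x y _ _ h
    rw [smul_mul_assoc]
    exact Submodule.smul_mem _ r h
  · intro r x y _ _ h
    rw [mul_smul_comm]
    exact Submodule.smul_mem _ r h

lemma star_mem_atomicSpan {f : C(OnePoint ℝ, ℂ)} (hf : f ∈ atomicSpan) : star f ∈ atomicSpan := by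
  refine Submodule.isClosed_topologicalClosure _ |>.closure_subset
    (map_mem_closure continuous_star hf fun a ha => ?_)
  refine Submodule.span_induction (p := fun a _ => star a ∈ atomicSpan) ?_ ?_ ?_ ?_ ha
  · rintro _ ⟨z, rfl⟩
    have h : star (atomicMap z) = atomicMap ⟨starRingEnd ℂ z, by simpa using z.2⟩ := by
      ext s
      simp [atomic_conj]
    rw [h]
    exact atomicMap_mem_atomicSpan _
  · simp
  · intro x y _ _ hx hy
    rw [star_add]
    exact add_mem hx hy
  · intro r x _ h
    rw [star_smul]
    exact Submodule.smul_mem _ _ h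

/-- The closed span of the atomic functions is a star algebra separating the points of the
boundary, so it is everything by Stone–Weierstrass. -/
theorem dense_span_atomicMap :
    Dense (Submodule.span ℂ (Set.range atomicMap) : Set C(OnePoint ℝ, ℂ)) := by
  let A : StarSubalgebra ℂ C(OnePoint ℝ, ℂ) :=
    { carrier := atomicSpan
      mul_mem' := mul_mem_atomicSpan
      add_mem' := atomicSpan.add_mem
      algebraMap_mem' := fun r => by
        rw [Algebra.algebraMap_eq_smul_one]
        exact Submodule.smul_mem _ _ one_mem_atomicSpan
      star_mem' := star_mem_atomicSpan }
  have hsep : A.SeparatesPoints := by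
    intro s t hst
    let z : {z : ℂ // z.im ≠ 0} := ⟨2 * Complex.I, by simp⟩
    refine ⟨atomicMap z, ⟨atomicMap z, atomicMap_mem_atomicSpan z, rfl⟩, fun h => hst ?_⟩
    exact circleCoord_injective (circleCoord_eq_of_atomic_eq h)
  have hA := ContinuousMap.starSubalgebra_topologicalClosure_eq_top_of_separatesPoints A hsep
  intro f
  have hf : f ∈ A.topologicalClosure := hA ▸ StarSubalgebra.mem_top
  have hf' : f ∈ closure (atomicSpan : Set C(OnePoint ℝ, ℂ)) := hf
  exact (Submodule.isClosed_topologicalClosure _).closure_subset hf'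

/-! ### Integration against finite measures on the boundary -/

lemma integrable_continuousMap (μ : Measure (OnePoint ℝ)) [IsFiniteMeasure μ]
    (f : C(OnePoint ℝ, ℂ)) : Integrable f μ :=
  (map_continuous f).integrable_of_hasCompactSupport (HasCompactSupport.of_compactSpace _)

/-- Integration of continuous functions against a finite measure, as a functional. -/
noncomputable def integralFunctional (μ : Measure (OnePoint ℝ)) [IsFiniteMeasure μ] :
    C(OnePoint ℝ, ℂ) →L[ℂ] ℂ :=
  LinearMap.mkContinuous
    { toFun := fun f => ∫ s, f s ∂μ
      map_add' := fun f g =>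
        integral_add (integrable_continuousMap μ f) (integrable_continuousMap μ g)
      map_smul' := fun c f => integral_const_mul c f }
    (μ.real Set.univ) fun f => by
      have h := norm_integral_le_of_norm_le_const (μ := μ)
        (Eventually.of_forall f.norm_coe_le_norm)
      rwa [mul_comm] at h

@[simp] lemma integralFunctional_apply (μ : Measure (OnePoint ℝ)) [IsFiniteMeasure μ]
    (f : C(OnePoint ℝ, ℂ)) : integralFunctional μ f = ∫ s, f s ∂μ := rfl

lemma integral_atomic_conj (μ : Measure (OnePoint ℝ)) (z : ℂ) :
    ∫ s, atomic s (starRingEnd ℂ z) ∂μ = starRingEnd ℂ (∫ s, atomic s z ∂μ) := by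
  simp_rw [atomic_conj]
  exact integral_conj

lemma measure_eq_of_integral_continuousMap_eq {μ ν : Measure (OnePoint ℝ)} [IsFiniteMeasure μ]
    [IsFiniteMeasure ν] (h : ∀ f : C(OnePoint ℝ, ℂ), ∫ s, f s ∂μ = ∫ s, f s ∂ν) : μ = ν := by
  refine ext_of_forall_integral_eq_of_IsFiniteMeasure fun f => ?_
  have h1 := h ⟨fun s => (f s : ℂ), by fun_prop⟩
  simp only [ContinuousMap.coe_mk, integral_complex_ofReal] at h1
  exact_mod_cast h1

/-- A finite measure on the boundary is determined by the integrals of the atomic functions of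
points in the upper half plane. -/
theorem measure_eq_of_integral_atomic_eq {μ ν : Measure (OnePoint ℝ)} [IsFiniteMeasure μ]
    [IsFiniteMeasure ν]
    (h : ∀ z ∈ upperHalfPlaneSet, ∫ s, atomic s z ∂μ = ∫ s, atomic s z ∂ν) : μ = ν := by
  refine measure_eq_of_integral_continuousMap_eq fun f => ?_
  have key : integralFunctional μ = integralFunctional ν := by
    refine ContinuousLinearMap.ext_on dense_span_atomicMap ?_
    rintro _ ⟨z, rfl⟩
    simp only [integralFunctional_apply, atomicMap_apply]
    rcases lt_or_gt_of_ne z.2 with hz | hz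
    · have h1 := h (starRingEnd ℂ z) (by simpa [upperHalfPlaneSet] using hz)
      rw [integral_atomic_conj, integral_atomic_conj] at h1
      exact (starRingEnd ℂ).injective h1
    · exact h z hz
  exact DFunLike.congr_fun key f

/-- Continuity of `x ↦ ∫ f dμₓ` for all continuous `f` may be tested on the atomic functions of
points in the upper half plane, if the total masses are bounded. -/
theorem continuous_integral_of_continuous_integral_atomic {X : Type*} [TopologicalSpace X]
    {μ : X → Measure (OnePoint ℝ)} [∀ x, IsFiniteMeasure (μ x)] {C : ℝ}
    (hC : ∀ x, (μ x).real Set.univ ≤ C)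
    (h : ∀ z ∈ upperHalfPlaneSet, Continuous fun x => ∫ s, atomic s z ∂(μ x))
    (f : C(OnePoint ℝ, ℂ)) : Continuous fun x => ∫ s, f s ∂(μ x) := by
  have hspan : ∀ g ∈ Submodule.span ℂ (Set.range atomicMap),
      Continuous fun x => integralFunctional (μ x) g := by
    intro g hg
    induction hg using Submodule.span_induction with
    | mem g hg =>
      obtain ⟨z, rfl⟩ := hg
      simp only [integralFunctional_apply, atomicMap_apply]
      rcases lt_or_gt_of_ne z.2 with hz | hz
      · have h1 := h (starRingEnd ℂ z) (by simpa [upperHalfPlaneSet] using hz)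
        simp_rw [integral_atomic_conj] at h1
        simpa [Function.comp_def] using Complex.continuous_conj.comp h1
      · exact h z hz
    | zero => simpa using continuous_const
    | add g₁ g₂ _ _ h₁ h₂ =>
      simp only [map_add]
      exact h₁.add h₂
    | smul c g _ hg =>
      simp only [map_smul]
      exact hg.const_smul c
  refine continuous_of_uniform_approx_of_continuous fun u hu => ?_
  obtain ⟨ε, hε, hεu⟩ := Metric.mem_uniformity_dist.1 hu
  obtain ⟨g, hg, hfg⟩ := Metric.dense_iff.1 dense_span_atomicMap f (ε / (|C| + 1)) (by positivity)
  refine ⟨_, hspan g hfg, fun x => hεu ?_⟩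
  rw [Metric.mem_ball, dist_comm] at hg
  have h1 : (∫ s, f s ∂(μ x)) - integralFunctional (μ x) g = ∫ s, (f - g) s ∂(μ x) := by
    rw [← integralFunctional_apply, ← integralFunctional_apply, map_sub]
  rw [dist_eq_norm, h1]
  have h2 := norm_integral_le_of_norm_le_const (μ := μ x)
    (Eventually.of_forall (f - g).norm_coe_le_norm)
  have h3 : (μ x).real Set.univ ≤ |C| := (hC x).trans (le_abs_self C)
  rw [dist_eq_norm, lt_div_iff₀ (by positivity)] at hg
  calc _ ≤ ‖f - g‖ * (μ x).real Set.univ := h2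
    _ ≤ ‖f - g‖ * (|C| + 1) := by gcongr; linarith
    _ < ε := hg

/-! ### Representing measures -/

lemma upperHalfPlaneSet_im_ne_zero {z : ℂ} (hz : z ∈ upperHalfPlaneSet) : z.im ≠ 0 :=
  ne_of_gt hz

lemma I_mem_upperHalfPlaneSet : Complex.I ∈ upperHalfPlaneSet := by
  simp [upperHalfPlaneSet]

theorem IsReprMeasure.unique {φ : ℂ → ℂ} {μ ν : Measure (OnePoint ℝ)} (hμ : IsReprMeasure φ μ)
    (hν : IsReprMeasure φ ν) : μ = ν := by
  have := hμ.finite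
  have := hν.finite
  refine measure_eq_of_integral_atomic_eq fun z hz => ?_
  have h := (hμ.repr z hz).symm.trans (hν.repr z hz)
  exact add_left_cancel h

lemma integral_atomic_I (μ : Measure (OnePoint ℝ)) :
    ∫ s, atomic s Complex.I ∂μ = μ.real Set.univ * Complex.I := by
  simp_rw [atomic_I]
  simp

/-- The total mass of the representing measure is the imaginary part at the base point `i`. -/
theorem IsReprMeasure.real_univ {φ : ℂ → ℂ} {μ : Measure (OnePoint ℝ)} (hμ : IsReprMeasure φ μ) :
    μ.real Set.univ = (φ Complex.I).im := by
  have h := hμ.repr Complex.I I_mem_upperHalfPlaneSet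
  rw [integral_atomic_I] at h
  have h2 := congrArg Complex.im h
  simpa using h2.symm

/-! ### The Herglotz–Riesz formula on the unit disk -/

lemma circleIntegrable_of_continuousOn_sphere {g : ℂ → ℂ}
    (hg : ContinuousOn g (Metric.sphere 0 1)) : CircleIntegrable g 0 1 :=
  ContinuousOn.circleIntegrable' (by simpa using hg)

/-- The Herglotz–Riesz formula: a holomorphic function on the disk, continuous up to the boundary,
is recovered from its boundary real part and the imaginary part at the centre. -/
theorem circleAverage_herglotzRieszKernel_mul_re {F : ℂ → ℂ} {w : ℂ}
    (hF : DiffContOnCl ℂ F (Metric.ball 0 1)) (hw : w ∈ Metric.ball (0 : ℂ) 1) :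
    Real.circleAverage (fun ζ => herglotzRieszKernel 0 w ζ * ((F ζ).re : ℂ)) 0 1
      = F w - Complex.I * ((F 0).im : ℂ) := by
  have hFc : ContinuousOn F (Metric.sphere 0 1) :=
    hF.continuousOn_ball.mono Metric.sphere_subset_closedBall
  have hH : ContinuousOn (herglotzRieszKernel 0 w) (Metric.sphere 0 1) := by
    simpa using continuousOn_herglotzRieszKernel_sphere hw
  have hne : ∀ ζ ∈ Metric.sphere (0 : ℂ) 1, ζ - w ≠ 0 := fun ζ hζ h => by
    rw [sub_eq_zero.1 h] at hζ
    simp_all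
  have hre : ContinuousOn (fun ζ => ((herglotzRieszKernel 0 w ζ).re : ℂ)) (Metric.sphere 0 1) := by
    fun_prop
  have hd : ContinuousOn (fun ζ => ζ / (ζ - w)) (Metric.sphere (0 : ℂ) 1) :=
    ContinuousOn.div (by fun_prop) (by fun_prop) hne
  have hci := @circleIntegrable_of_continuousOn_sphere
  have h0 : Real.circleAverage F 0 1 = F 0 :=
    DiffContOnCl.circleAverage (by simpa using hF)
  -- Cauchy's formula, as the kernel is `2 ζ / (ζ - w) - 1`
  have h1 : Real.circleAverage (fun ζ => herglotzRieszKernel 0 w ζ * F ζ) 0 1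
      = 2 * F w - F 0 := by
    have e : Set.EqOn (fun ζ => herglotzRieszKernel 0 w ζ * F ζ)
        (fun ζ => (2 : ℂ) • (ζ / (ζ - w) * F ζ) - F ζ) (Metric.sphere 0 |1|) := fun ζ hζ => by
      have := hne ζ (by simpa using hζ)
      simp only [herglotzRieszKernel_def, sub_zero, smul_eq_mul]
      field_simp
      ring
    have h2 := DiffContOnCl.circleAverage_smul_div (f := F) (c := 0) (R := 1) (w := w)
      (by simpa using hF) (by simpa using hw)
    simp only [sub_zero, smul_eq_mul] at h2
    rw [Real.circleAverage_congr_sphere e, Real.circleAverage_fun_sub (hci (by fun_prop))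
      (hci hFc), Real.circleAverage_fun_smul, h2, h0, smul_eq_mul]
  have h2 : Real.circleAverage (fun ζ => ((herglotzRieszKernel 0 w ζ).re : ℂ) * F ζ) 0 1
      = F w := by
    rw [← hF.circleAverage_re_herglotzRieszKernel_smul hw]
    congr 1
  -- the conjugate kernel gives the value at the centre, by subtraction from Poisson's formula `h2`
  have h3 : Real.circleAverage
      (fun ζ => starRingEnd ℂ (herglotzRieszKernel 0 w ζ) * F ζ) 0 1 = F 0 := by
    have e : (fun ζ => starRingEnd ℂ (herglotzRieszKernel 0 w ζ) * F ζ) = fun ζ =>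
        (2 : ℂ) • (((herglotzRieszKernel 0 w ζ).re : ℂ) * F ζ)
          - herglotzRieszKernel 0 w ζ * F ζ := by
      ext ζ
      rw [Complex.re_eq_add_conj]
      simp only [smul_eq_mul]
      ring
    rw [e, Real.circleAverage_fun_sub (hci (by fun_prop)) (hci (by fun_prop)),
      Real.circleAverage_fun_smul, h1, h2, smul_eq_mul]
    ring
  have h4 : Real.circleAverage
      (fun ζ => herglotzRieszKernel 0 w ζ * starRingEnd ℂ (F ζ)) 0 1
      = starRingEnd ℂ (F 0) := by
    have hc : ContinuousOn (fun ζ => starRingEnd ℂ (herglotzRieszKernel 0 w ζ) * F ζ)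
        (Metric.sphere 0 1) := (Complex.continuous_conj.comp_continuousOn hH).mul hFc
    have h5 := (Complex.conjCLE : ℂ →L[ℝ] ℂ).circleAverage_comp_comm (hci hc)
    rw [h3] at h5
    rw [← Complex.conjCLE_apply]
    refine Eq.trans ?_ h5
    congr 1
    ext ζ
    simp
  have e : (fun ζ => herglotzRieszKernel 0 w ζ * ((F ζ).re : ℂ)) = fun ζ =>
      (1 / 2 : ℂ) • (herglotzRieszKernel 0 w ζ * F ζ)
        + (1 / 2 : ℂ) • (herglotzRieszKernel 0 w ζ * starRingEnd ℂ (F ζ)) := by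
    ext ζ
    rw [Complex.re_eq_add_conj]
    simp only [smul_eq_mul]
    ring
  have hcF : ContinuousOn (fun ζ => starRingEnd ℂ (F ζ)) (Metric.sphere 0 1) :=
    Complex.continuous_conj.comp_continuousOn hFc
  rw [e, Real.circleAverage_fun_add (hci (by fun_prop)) (hci (by fun_prop)),
    Real.circleAverage_fun_smul, Real.circleAverage_fun_smul, h1, h4, Complex.im_eq_sub_conj]
  simp only [smul_eq_mul]
  field_simp
  ring

/-! ### Representing measures of functions continuous up to the boundary -/

lemma circleCoord_surjective {ζ : ℂ} (hζ : ‖ζ‖ = 1) : ∃ s, circleCoord s = ζ := by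
  by_cases h : ζ = 1
  · exact ⟨OnePoint.infty, h.symm⟩
  have h1 : 1 - ζ ≠ 0 := sub_ne_zero.2 (Ne.symm h)
  have h0 : ζ ≠ 0 := by
    rintro rfl
    simp at hζ
  have hinv : starRingEnd ℂ ζ = ζ⁻¹ := (Complex.inv_eq_conj hζ).symm
  obtain ⟨x, hx⟩ : ∃ x : ℝ, (x : ℂ) = Complex.I * (1 + ζ) / (1 - ζ) := by
    have h2 : ζ - 1 ≠ 0 := sub_ne_zero.2 h
    have h3 : 1 - ζ⁻¹ ≠ 0 := sub_ne_zero.2 fun h4 => h (by simpa using h4.symm)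
    refine (Complex.conj_eq_iff_real.1 ?_).imp fun x hx => hx.symm
    simp only [map_div₀, map_mul, map_add, map_sub, map_one, hinv, Complex.conj_I]
    rw [div_eq_div_iff h3 h1]
    field_simp
    ring
  refine ⟨x, ?_⟩
  change ((x : ℂ) - Complex.I) / ((x : ℂ) + Complex.I) = ζ
  rw [div_eq_iff (ofReal_add_I_ne_zero x), hx]
  field_simp
  ring

/-- The boundary is homeomorphic to the unit circle, by the circle coordinate. -/
noncomputable def boundaryHomeomorphCircle : OnePoint ℝ ≃ₜ Circle :=
  Continuous.homeoOfEquivCompactToT2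
    (f := Equiv.ofBijective
      (fun s => (⟨circleCoord s, mem_sphere_zero_iff_norm.2 (norm_circleCoord s)⟩ : Circle))
      ⟨fun _ _ h => circleCoord_injective (congrArg Subtype.val h), fun ζ =>
        (circleCoord_surjective ζ.norm_coe).imp fun _ hs => Subtype.ext hs⟩)
    (continuous_circleCoord.subtype_mk _)

lemma circleCoord_boundaryHomeomorphCircle_symm (ζ : Circle) :
    circleCoord (boundaryHomeomorphCircle.symm ζ) = ζ :=
  congrArg Subtype.val (boundaryHomeomorphCircle.apply_symm_apply ζ)

/-- If `G` is holomorphic in the disk and continuous up to the circle, with nonnegative imaginary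
part there, the boundary values of `Im G` are the density of a measure whose Herglotz transform is
`G`, up to a real constant. -/
theorem exists_measure_of_diffContOnCl {G : ℂ → ℂ} (hG : DiffContOnCl ℂ G (Metric.ball 0 1))
    (him : ∀ ζ ∈ Metric.sphere (0 : ℂ) 1, 0 ≤ (G ζ).im) :
    ∃ μ : Measure (OnePoint ℝ), IsFiniteMeasure μ ∧ ∀ w ∈ Metric.ball (0 : ℂ) 1,
      ∫ s, Complex.I * herglotzRieszKernel 0 w (circleCoord s) ∂μ = G w - ((G 0).re : ℂ) := by
  have hcont : Continuous fun θ : ℝ => (2 * Real.pi)⁻¹ * (G (Circle.exp θ)).im := by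
    have h1 : Continuous fun θ : ℝ => G (Circle.exp θ) :=
      hG.continuousOn_ball.comp_continuous (by fun_prop) fun θ => by simp
    exact continuous_const.mul (Complex.continuous_im.comp h1)
  have hnonneg : ∀ θ : ℝ, 0 ≤ (2 * Real.pi)⁻¹ * (G (Circle.exp θ)).im := fun θ =>
    mul_nonneg (by positivity) (him _ (by simp))
  have hfin : IsFiniteMeasure ((volume.restrict (Set.Ioc 0 (2 * Real.pi))).withDensity
      fun θ => ENNReal.ofReal ((2 * Real.pi)⁻¹ * (G (Circle.exp θ)).im)) :=
    isFiniteMeasure_withDensity_ofReal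
      (hcont.integrableOn_Ioc (μ := volume) (a := 0) (b := 2 * Real.pi)).2
  have hσ : Continuous fun θ : ℝ => boundaryHomeomorphCircle.symm (Circle.exp θ) := by
    fun_prop
  refine ⟨((volume.restrict (Set.Ioc 0 (2 * Real.pi))).withDensity
    fun θ => ENNReal.ofReal ((2 * Real.pi)⁻¹ * (G (Circle.exp θ)).im)).map
      fun θ => boundaryHomeomorphCircle.symm (Circle.exp θ), inferInstance, fun w hw => ?_⟩
  have hH : Continuous fun s => herglotzRieszKernel 0 w (circleCoord s) := by
    have h1 := continuousOn_herglotzRieszKernel_sphere hw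
    exact h1.comp_continuous continuous_circleCoord fun s => by simp [norm_circleCoord]
  -- the function whose real part is the imaginary part of `G`
  have hF : DiffContOnCl ℂ (fun ζ => -Complex.I * G ζ) (Metric.ball 0 1) := by
    exact hG.const_smul (-Complex.I)
  have h := circleAverage_herglotzRieszKernel_mul_re hF hw
  rw [integral_map hσ.aemeasurable (hH.const_mul _).aestronglyMeasurable,
    integral_withDensity_eq_integral_toReal_smul hcont.measurable.ennreal_ofReal (by simp)]
  simp only [circleCoord_boundaryHomeomorphCircle_symm]
  simp_rw [ENNReal.toReal_ofReal (hnonneg _)]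
  rw [Real.circleAverage_def, intervalIntegral.integral_of_le (by positivity)] at h
  have h2 := congrArg (fun c => Complex.I * c) h
  simp only [← integral_smul, ← integral_const_mul] at h2
  convert h2 using 1
  · refine integral_congr_ae (Eventually.of_forall fun θ => ?_)
    simp [circleMap]
    ring
  · ring_nf
    simp

/-! ### Existence of the representing measure -/

/-- The Cayley transform from the upper half plane to the unit disk. -/
noncomputable def cayley (z : ℂ) : ℂ := (z - Complex.I) / (z + Complex.I)

/-- The inverse Cayley transform, from the unit disk to the upper half plane. -/
noncomputable def cayleyInv (w : ℂ) : ℂ := Complex.I * (1 + w) / (1 - w)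

lemma add_I_ne_zero_of_mem_upperHalfPlaneSet {z : ℂ} (hz : z ∈ upperHalfPlaneSet) :
    z + Complex.I ≠ 0 := fun h => by
  have h1 : 0 < z.im := hz
  have h2 := congrArg Complex.im h
  simp only [Complex.add_im, Complex.I_im, Complex.zero_im] at h2
  linarith

lemma cayley_mem_ball {z : ℂ} (hz : z ∈ upperHalfPlaneSet) :
    cayley z ∈ Metric.ball (0 : ℂ) 1 := by
  have h1 : 0 < z.im := hz
  rw [mem_ball_zero_iff, cayley, norm_div,
    div_lt_one (norm_pos_iff.2 (add_I_ne_zero_of_mem_upperHalfPlaneSet hz)),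
    ← sq_lt_sq₀ (norm_nonneg _) (norm_nonneg _), ← Complex.normSq_eq_norm_sq,
    ← Complex.normSq_eq_norm_sq]
  simp only [Complex.normSq_apply, Complex.sub_re, Complex.sub_im, Complex.add_re, Complex.add_im,
    Complex.I_re, Complex.I_im]
  linarith

lemma one_sub_ne_zero_of_mem_ball {w : ℂ} (hw : w ∈ Metric.ball (0 : ℂ) 1) : 1 - w ≠ 0 := by
  intro h
  rw [← sub_eq_zero.1 h] at hw
  simp at hw

lemma cayleyInv_mem {w : ℂ} (hw : w ∈ Metric.ball (0 : ℂ) 1) :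
    cayleyInv w ∈ upperHalfPlaneSet := by
  have h1 := Complex.normSq_pos.2 (one_sub_ne_zero_of_mem_ball hw)
  have h2 : Complex.normSq w < 1 := by
    rw [Complex.normSq_eq_norm_sq]
    have := mem_ball_zero_iff.1 hw
    nlinarith [norm_nonneg w]
  have h3 : (cayleyInv w).im = (1 - Complex.normSq w) / Complex.normSq (1 - w) := by
    rw [cayleyInv, Complex.div_im]
    simp only [Complex.mul_re, Complex.mul_im, Complex.add_re, Complex.add_im, Complex.sub_re,
      Complex.sub_im, Complex.I_re, Complex.I_im, Complex.one_re, Complex.one_im,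
      Complex.normSq_apply]
    ring
  change 0 < (cayleyInv w).im
  rw [h3]
  exact div_pos (by linarith) h1

lemma cayleyInv_cayley {z : ℂ} (hz : z ∈ upperHalfPlaneSet) : cayleyInv (cayley z) = z := by
  rw [cayleyInv, div_eq_iff (one_sub_ne_zero_of_mem_ball (cayley_mem_ball hz)), cayley]
  have := add_I_ne_zero_of_mem_upperHalfPlaneSet hz
  field_simp
  ring

@[simp] lemma cayley_I : cayley Complex.I = 0 := by simp [cayley]

@[simp] lemma cayleyInv_zero : cayleyInv 0 = Complex.I := by simp [cayleyInv]

lemma differentiableOn_cayleyInv : DifferentiableOn ℂ cayleyInv (Metric.ball 0 1) := by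
  unfold cayleyInv
  exact DifferentiableOn.div (by fun_prop) (by fun_prop) fun w => one_sub_ne_zero_of_mem_ball

lemma atomic_eq_herglotzRieszKernel {z : ℂ} (hz : z ∈ upperHalfPlaneSet) (s : OnePoint ℝ) :
    atomic s z = Complex.I * herglotzRieszKernel 0 (cayley z) (circleCoord s) := by
  have h1 := add_I_ne_zero_of_mem_upperHalfPlaneSet hz
  have h2 := circleCoord_mul_sub_ne_zero (upperHalfPlaneSet_im_ne_zero hz) s
  have h3 : circleCoord s - cayley z
      = (circleCoord s * (z + Complex.I) - (z - Complex.I)) / (z + Complex.I) := by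
    rw [cayley]
    field_simp
  have h4 : circleCoord s + cayley z
      = (circleCoord s * (z + Complex.I) + (z - Complex.I)) / (z + Complex.I) := by
    rw [cayley]
    field_simp
  rw [atomic_eq_circleCoord (upperHalfPlaneSet_im_ne_zero hz), herglotzRieszKernel_def]
  simp only [sub_zero]
  rw [h3, h4, div_div_div_cancel_right₀ h1, mul_div_assoc]

lemma ofReal_mul_mem_ball {r : ℝ} (hr0 : 0 ≤ r) (hr : r < 1) {w : ℂ}
    (hw : w ∈ Metric.closedBall (0 : ℂ) 1) : (r : ℂ) * w ∈ Metric.ball (0 : ℂ) 1 := by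
  rw [mem_closedBall_zero_iff] at hw
  rw [mem_ball_zero_iff, norm_mul, Complex.norm_real, Real.norm_of_nonneg hr0]
  nlinarith

/-- The dilates `z ↦ φ(C⁻¹(r C(z)))` of an endofunction, with `C` the Cayley transform, are
continuous up to the boundary and so have representing measures; they fix the value at `i`. -/
lemma IsEndofunction.exists_measure_dilate {φ : ℂ → ℂ} (hφ : IsEndofunction φ) {r : ℝ}
    (hr0 : 0 ≤ r) (hr : r < 1) :
    ∃ μ : Measure (OnePoint ℝ), IsFiniteMeasure μ ∧ ∀ z ∈ upperHalfPlaneSet,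
      ∫ s, atomic s z ∂μ = φ (cayleyInv (r * cayley z)) - ((φ Complex.I).re : ℂ) := by
  have hmap : Set.MapsTo (fun w : ℂ => cayleyInv (r * w)) (Metric.closedBall 0 1)
      upperHalfPlaneSet := fun w hw => cayleyInv_mem (ofReal_mul_mem_ball hr0 hr hw)
  have hd : DifferentiableOn ℂ (fun w : ℂ => φ (cayleyInv (r * w))) (Metric.closedBall 0 1) :=
    hφ.holomorphic.comp (differentiableOn_cayleyInv.comp (by fun_prop)
      fun w hw => ofReal_mul_mem_ball hr0 hr hw) hmap
  obtain ⟨μ, hμ, h⟩ := exists_measure_of_diffContOnCl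
    (DifferentiableOn.diffContOnCl (by rwa [closure_ball _ one_ne_zero]))
    (fun ζ hζ => (hφ.mapsTo (hmap (Metric.sphere_subset_closedBall hζ))).le)
  refine ⟨μ, hμ, fun z hz => ?_⟩
  simp_rw [atomic_eq_herglotzRieszKernel hz]
  simpa using h _ (cayley_mem_ball hz)

lemma continuous_integral_atomic_finiteMeasure {z : ℂ} (hz : z.im ≠ 0) :
    Continuous fun μ : FiniteMeasure (OnePoint ℝ) => ∫ s, atomic s z ∂(μ : Measure _) := by
  have hint : ∀ μ : FiniteMeasure (OnePoint ℝ), Integrable (fun s => atomic s z) (μ : Measure _) :=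
    fun μ => integrable_continuousMap μ (atomicMap ⟨z, hz⟩)
  have e : (fun μ : FiniteMeasure (OnePoint ℝ) => ∫ s, atomic s z ∂(μ : Measure _)) =
      fun μ : FiniteMeasure (OnePoint ℝ) => ((∫ s, (atomic s z).re ∂(μ : Measure _) : ℝ) : ℂ)
        + ((∫ s, (atomic s z).im ∂(μ : Measure _) : ℝ) : ℂ) * Complex.I := by
    ext μ
    exact (integral_re_add_im (hint μ)).symm
  have hc := continuous_atomic hz
  have hre := FiniteMeasure.continuous_integral_boundedContinuousFunction
    (BoundedContinuousFunction.mkOfCompact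
      (⟨_, Complex.continuous_re.comp hc⟩ : C(OnePoint ℝ, ℝ)))
  have him := FiniteMeasure.continuous_integral_boundedContinuousFunction
    (BoundedContinuousFunction.mkOfCompact
      (⟨_, Complex.continuous_im.comp hc⟩ : C(OnePoint ℝ, ℝ)))
  rw [e]
  exact (Complex.continuous_ofReal.comp hre).add
    ((Complex.continuous_ofReal.comp him).mul continuous_const)

/-- **Nevanlinna's representation**: the measures of the dilates all have mass `Im φ(i)`, and a
cluster point of them, as the dilation factor tends to `1`, represents `φ`. -/
theorem IsEndofunction.exists_isReprMeasure {φ : ℂ → ℂ} (hφ : IsEndofunction φ) :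
    ∃ μ, IsReprMeasure φ μ := by
  let r : ℕ → ℝ := fun n => 1 - 1 / ((n : ℝ) + 1)
  have hr0 : ∀ n, 0 ≤ r n := fun n => by
    have : 1 / ((n : ℝ) + 1) ≤ 1 := by
      rw [div_le_one (by positivity)]
      linarith [(Nat.cast_nonneg n : (0 : ℝ) ≤ n)]
    simp only [r]
    linarith
  have hr1 : ∀ n, r n < 1 := fun n => sub_lt_self _ (by positivity)
  have hr : Tendsto r atTop (𝓝 1) := by
    simpa [r] using (tendsto_one_div_add_atTop_nhds_zero_nat (𝕜 := ℝ)).const_sub 1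
  choose μ hμ hrep using fun n => hφ.exists_measure_dilate (hr0 n) (hr1 n)
  have hmass : ∀ n, (μ n).real Set.univ = (φ Complex.I).im := fun n => by
    have h1 := hrep n _ I_mem_upperHalfPlaneSet
    rw [integral_atomic_I] at h1
    simpa using congrArg Complex.im h1
  let m : ℕ → FiniteMeasure (OnePoint ℝ) := fun n => ⟨μ n, hμ n⟩
  -- the measures of the dilates lie in a compact set, as the boundary is compact
  obtain ⟨ν, -, hν⟩ := (isCompact_setOfPred_finiteMeasure_le_of_compactSpace (OnePoint ℝ)
    (φ Complex.I).im.toNNReal).exists_mapClusterPt (f := atTop) (u := m)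
    (tendsto_principal.2 <| Eventually.of_forall fun n => by
      change (m n).mass ≤ _
      rw [← hmass n]
      exact (Real.le_toNNReal_iff_coe_le measureReal_nonneg).2 le_rfl)
  refine ⟨ν, inferInstance, fun z hz => ?_⟩
  have h1 : Tendsto (fun n => ∫ s, atomic s z ∂(m n : Measure _)) atTop
      (𝓝 (φ z - ((φ Complex.I).re : ℂ))) := by
    have h2 : Tendsto (fun n => (r n : ℂ) * cayley z) atTop (𝓝 (cayley z)) := by
      simpa using ((Complex.continuous_ofReal.tendsto _).comp hr).mul_const (cayley z)
    have h3 : ContinuousAt cayleyInv (cayley z) :=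
      (differentiableOn_cayleyInv.differentiableAt
        (Metric.isOpen_ball.mem_nhds (cayley_mem_ball hz))).continuousAt
    have h4 : ContinuousAt φ z :=
      (hφ.holomorphic.differentiableAt (isOpen_upperHalfPlaneSet.mem_nhds hz)).continuousAt
    have h5 := h3.tendsto.comp h2
    rw [cayleyInv_cayley hz] at h5
    have h6 := (h4.tendsto.comp h5).sub_const ((φ Complex.I).re : ℂ)
    exact h6.congr fun n => (hrep n z hz).symm
  have h2 : MapClusterPt (∫ s, atomic s z ∂(ν : Measure _)) atTop
      (fun n => ∫ s, atomic s z ∂(m n : Measure _)) :=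
    hν.continuousAt_comp
      (continuous_integral_atomic_finiteMeasure (upperHalfPlaneSet_im_ne_zero hz)).continuousAt
  rw [eq_of_nhds_neBot (NeBot.mono h2 (inf_le_inf_left _ h1))]
  ring

lemma IsEndofunction.isReprMeasure_reprMeasure {φ : ℂ → ℂ} (hφ : IsEndofunction φ) :
    IsReprMeasure φ (reprMeasure φ) := by
  rw [reprMeasure, dif_pos hφ.exists_isReprMeasure]
  exact hφ.exists_isReprMeasure.choose_spec

/-! ### Mixtures of weakly continuous families of measures -/

/-- A family of finite measures that depends continuously on the parameter in the weak sense is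
measurable, since indicators of closed sets are limits of continuous functions. -/
lemma measurable_of_continuous_integral {μ : OnePoint ℝ → Measure (OnePoint ℝ)}
    [∀ s, IsFiniteMeasure (μ s)]
    (h : ∀ f : C(OnePoint ℝ, ℂ), Continuous fun s => ∫ t, f t ∂(μ s)) : Measurable μ := by
  have hreal : ∀ f : C(OnePoint ℝ, ℝ), Measurable fun s => ∫ t, f t ∂(μ s) := fun f => by
    have h1 := (Complex.continuous_re.comp (h ⟨fun t => (f t : ℂ), by fun_prop⟩)).measurable
    simpa [Function.comp_def, integral_complex_ofReal] using h1
  have hclosed : ∀ F : Set (OnePoint ℝ), IsClosed F → Measurable fun s => μ s F := by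
    intro F hF
    refine measurable_of_tendsto_metrizable (f := fun n s => ∫⁻ t, hF.apprSeq n t ∂(μ s)) ?_
      (tendsto_pi_nhds.2 fun s => HasOuterApproxClosed.tendsto_lintegral_apprSeq hF (μ s))
    intro n
    have h1 := (hreal ⟨fun t => (hF.apprSeq n t : ℝ), by fun_prop⟩).ennreal_ofReal
    convert h1 using 2 with s
    rw [ContinuousMap.coe_mk, ofReal_integral_eq_lintegral_ofReal]
    · simp
    · exact Continuous.integrable_of_hasCompactSupport (by fun_prop)
        (HasCompactSupport.of_compactSpace _)
    · exact Eventually.of_forall fun t => NNReal.coe_nonneg _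
  exact Measurable.measure_of_isPiSystem
    (BorelSpace.measurable_eq.trans borel_eq_generateFrom_isClosed) isPiSystem_isClosed
    (fun F hF => hclosed F hF) (hclosed _ isClosed_univ)

lemma integral_bind_of_measurable {ν : Measure (OnePoint ℝ)}
    {μ : OnePoint ℝ → Measure (OnePoint ℝ)} (hμ : Measurable μ) [IsFiniteMeasure (ν.bind μ)]
    (f : C(OnePoint ℝ, ℂ)) :
    ∫ t, f t ∂(ν.bind μ) = ∫ s, (∫ t, f t ∂(μ s)) ∂ν := by
  -- the mixture is the composition of the kernel with the constant kernel `ν`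
  let κ : ProbabilityTheory.Kernel (OnePoint ℝ) (OnePoint ℝ) := ⟨μ, hμ⟩
  have h := ProbabilityTheory.Kernel.integral_comp (η := κ)
    (κ := ProbabilityTheory.Kernel.const Unit ν) (a := ()) (f := f)
  simp only [ProbabilityTheory.Kernel.comp_apply, ProbabilityTheory.Kernel.const_apply] at h
  exact h (integrable_continuousMap (ν.bind μ) f)

lemma isFiniteMeasure_bind {ν : Measure (OnePoint ℝ)} [IsFiniteMeasure ν]
    {μ : OnePoint ℝ → Measure (OnePoint ℝ)} (hμ : Measurable μ) [∀ s, IsFiniteMeasure (μ s)]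
    {C : ℝ} (hC : ∀ s, (μ s).real Set.univ ≤ C) : IsFiniteMeasure (ν.bind μ) := by
  refine ⟨?_⟩
  rw [Measure.bind_apply MeasurableSet.univ hμ.aemeasurable]
  calc ∫⁻ s, μ s Set.univ ∂ν ≤ ∫⁻ _, ENNReal.ofReal C ∂ν := lintegral_mono fun s =>
        (ENNReal.le_ofReal_iff_toReal_le (measure_ne_top _ _)
          (measureReal_nonneg.trans (hC s))).2 (hC s)
    _ < ⊤ := by
      rw [lintegral_const]
      exact ENNReal.mul_lt_top ENNReal.ofReal_lt_top (measure_lt_top _ _)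

/-! ### Left translates of an endomatrix -/

lemma isEndofunction_atomic (s : OnePoint ℝ) : IsEndofunction (atomic s) := by
  induction s using OnePoint.rec with
  | infty => exact ⟨differentiableOn_id, Set.mapsTo_id _⟩
  | coe x =>
    have hne : ∀ z ∈ upperHalfPlaneSet, (x : ℂ) - z ≠ 0 := fun z hz =>
      ofReal_sub_ne_zero (upperHalfPlaneSet_im_ne_zero hz) x
    refine ⟨DifferentiableOn.div (by fun_prop) (by fun_prop) hne, fun z hz => ?_⟩
    have h0 : 0 < z.im := hz
    have h1 : (atomic x z).im = (1 + x ^ 2) * z.im / Complex.normSq ((x : ℂ) - z) := by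
      change ((1 + (x : ℂ) * z) / ((x : ℂ) - z)).im = _
      rw [Complex.div_im]
      simp only [Complex.mul_re, Complex.mul_im, Complex.add_re, Complex.add_im, Complex.sub_re,
        Complex.sub_im, Complex.one_re, Complex.one_im, Complex.ofReal_re, Complex.ofReal_im]
      ring
    change 0 < (atomic x z).im
    rw [h1]
    exact div_pos (by positivity) (Complex.normSq_pos.2 (hne z hz))

/-- The pole of the linear fractional function of an endomatrix lies outside the upper half
plane: at a pole `mobius` takes the value `0`, which is not in the upper half plane. -/
lemma IsEndomatrix.denom_ne_zero {M : Matrix (Fin 2) (Fin 2) ℂ} (hM : IsEndomatrix M) {z : ℂ}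
    (hz : z ∈ upperHalfPlaneSet) : M 1 0 * z + M 1 1 ≠ 0 := by
  intro h
  have h1 : 0 < (mobius M z).im := hM.mapsTo hz
  rw [mobius, h, div_zero] at h1
  simp at h1

lemma IsEndomatrix.isEndofunction {M : Matrix (Fin 2) (Fin 2) ℂ} (hM : IsEndomatrix M) :
    IsEndofunction (mobius M) :=
  ⟨DifferentiableOn.div (by fun_prop) (by fun_prop) fun _ hz => hM.denom_ne_zero hz, hM.mapsTo⟩

lemma mobius_leftTranslate {M : Matrix (Fin 2) (Fin 2) ℂ} (hM : IsEndomatrix M)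
    (s : OnePoint ℝ) {z : ℂ} (hz : z ∈ upperHalfPlaneSet) :
    mobius (leftTranslate s M) z = atomic s (mobius M z) := by
  induction s using OnePoint.rec with
  | infty => rfl
  | coe x =>
    have hd := hM.denom_ne_zero hz
    have hn := ofReal_sub_ne_zero (upperHalfPlaneSet_im_ne_zero (hM.mapsTo hz)) x
    have hc : (((Real.sqrt (1 + x ^ 2))⁻¹ : ℝ) : ℂ) ≠ 0 :=
      Complex.ofReal_ne_zero.2 (inv_ne_zero (Real.sqrt_pos.2 (by positivity)).ne')
    change mobius ((((Real.sqrt (1 + x ^ 2))⁻¹ : ℝ) : ℂ) • (!![(x : ℂ), 1; -1, (x : ℂ)] * M)) z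
      = (1 + (x : ℂ) * mobius M z) / ((x : ℂ) - mobius M z)
    generalize (((Real.sqrt (1 + x ^ 2))⁻¹ : ℝ) : ℂ) = c at hc
    unfold mobius at hn ⊢
    simp only [Matrix.smul_apply, Matrix.mul_apply, Fin.sum_univ_two, Matrix.of_apply,
      Matrix.cons_val', Matrix.cons_val_zero, Matrix.cons_val_one, Matrix.cons_val_fin_one,
      smul_eq_mul]
    have e1 : c * ((x : ℂ) * M 0 0 + 1 * M 1 0) * z + c * ((x : ℂ) * M 0 1 + 1 * M 1 1)
        = c * ((x : ℂ) * (M 0 0 * z + M 0 1) + (M 1 0 * z + M 1 1)) := by ring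
    have e2 : c * (-1 * M 0 0 + (x : ℂ) * M 1 0) * z + c * (-1 * M 0 1 + (x : ℂ) * M 1 1)
        = c * ((x : ℂ) * (M 1 0 * z + M 1 1) - (M 0 0 * z + M 0 1)) := by ring
    rw [e1, e2, mul_div_mul_left _ _ hc]
    generalize M 0 0 * z + M 0 1 = p at hn ⊢
    generalize M 1 0 * z + M 1 1 = q at hd hn ⊢
    have h1 : (x : ℂ) - p / q = ((x : ℂ) * q - p) / q := by field_simp
    have h2 : 1 + (x : ℂ) * (p / q) = ((x : ℂ) * p + q) / q := by
      field_simp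
      ring
    rw [h1, h2, div_div_div_cancel_right₀ hd]

lemma IsEndofunction.comp {φ ψ : ℂ → ℂ} (hφ : IsEndofunction φ) (hψ : IsEndofunction ψ) :
    IsEndofunction fun z => φ (ψ z) :=
  ⟨hφ.holomorphic.comp hψ.holomorphic hψ.mapsTo, hφ.mapsTo.comp hψ.mapsTo⟩

lemma IsEndofunction.congr {φ ψ : ℂ → ℂ} (hφ : IsEndofunction φ)
    (h : Set.EqOn ψ φ upperHalfPlaneSet) : IsEndofunction ψ :=
  ⟨hφ.holomorphic.congr h, hφ.mapsTo.congr h.symm⟩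

section translate

variable {M : Matrix (Fin 2) (Fin 2) ℂ}

lemma IsEndomatrix.isEndofunction_leftTranslate (hM : IsEndomatrix M) (s : OnePoint ℝ) :
    IsEndofunction (mobius (leftTranslate s M)) :=
  ((isEndofunction_atomic s).comp hM.isEndofunction).congr fun _ hz => mobius_leftTranslate hM s hz

lemma IsEndomatrix.isReprMeasure_translateMeasure (hM : IsEndomatrix M) (s : OnePoint ℝ) :
    IsReprMeasure (mobius (leftTranslate s M)) (translateMeasure M s) :=
  (hM.isEndofunction_leftTranslate s).isReprMeasure_reprMeasure

lemma IsEndomatrix.integral_atomic_translateMeasure (hM : IsEndomatrix M) (s : OnePoint ℝ) {z : ℂ}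
    (hz : z ∈ upperHalfPlaneSet) :
    ∫ t, atomic t z ∂(translateMeasure M s)
      = atomic s (mobius M z) - ((atomic s (mobius M Complex.I)).re : ℂ) := by
  have h := (hM.isReprMeasure_translateMeasure s).repr z hz
  rw [mobius_leftTranslate hM s hz, mobius_leftTranslate hM s I_mem_upperHalfPlaneSet] at h
  rw [h]
  ring

lemma IsEndomatrix.continuous_atomic_mobius (hM : IsEndomatrix M) {z : ℂ}
    (hz : z ∈ upperHalfPlaneSet) : Continuous fun s => atomic s (mobius M z) :=
  continuous_atomic (upperHalfPlaneSet_im_ne_zero (hM.mapsTo hz))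

/-- The masses `Im φ_s(M.i)` of the measures of the left translates are bounded, being a continuous
function of `s` on a compact space. -/
lemma IsEndomatrix.exists_translateMeasure_real_univ_le (hM : IsEndomatrix M) :
    ∃ C : ℝ, ∀ s, (translateMeasure M s).real Set.univ ≤ C := by
  have hc := Complex.continuous_im.comp (hM.continuous_atomic_mobius I_mem_upperHalfPlaneSet)
  obtain ⟨C, hC⟩ := (isCompact_range hc).bddAbove
  refine ⟨C, fun s => ?_⟩
  rw [(hM.isReprMeasure_translateMeasure s).real_univ,
    mobius_leftTranslate hM s I_mem_upperHalfPlaneSet]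
  exact hC ⟨s, rfl⟩

theorem IsEndomatrix.continuous_integral_translateMeasure (hM : IsEndomatrix M)
    (f : C(OnePoint ℝ, ℂ)) : Continuous fun s => ∫ t, f t ∂(translateMeasure M s) := by
  have (s : OnePoint ℝ) := (hM.isReprMeasure_translateMeasure s).finite
  obtain ⟨C, hC⟩ := hM.exists_translateMeasure_real_univ_le
  refine continuous_integral_of_continuous_integral_atomic hC (fun z hz => ?_) f
  simp_rw [hM.integral_atomic_translateMeasure _ hz]
  exact (hM.continuous_atomic_mobius hz).sub (Complex.continuous_ofReal.comp
    (Complex.continuous_re.comp (hM.continuous_atomic_mobius I_mem_upperHalfPlaneSet)))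

lemma IsEndomatrix.measurable_translateMeasure (hM : IsEndomatrix M) :
    Measurable (translateMeasure M) := by
  have (s : OnePoint ℝ) := (hM.isReprMeasure_translateMeasure s).finite
  exact measurable_of_continuous_integral hM.continuous_integral_translateMeasure

lemma IsEndomatrix.isFiniteMeasure_mixture (hM : IsEndomatrix M) (ν : Measure (OnePoint ℝ))
    [IsFiniteMeasure ν] : IsFiniteMeasure (mixture ν M) := by
  have (s : OnePoint ℝ) := (hM.isReprMeasure_translateMeasure s).finite
  obtain ⟨C, hC⟩ := hM.exists_translateMeasure_real_univ_le
  exact isFiniteMeasure_bind hM.measurable_translateMeasure hC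

theorem IsEndomatrix.integral_mixture (hM : IsEndomatrix M) (ν : Measure (OnePoint ℝ))
    [IsFiniteMeasure ν] (f : C(OnePoint ℝ, ℂ)) :
    ∫ t, f t ∂(mixture ν M) = ∫ s, (∫ t, f t ∂(translateMeasure M s)) ∂ν := by
  have : IsFiniteMeasure (ν.bind (translateMeasure M)) := hM.isFiniteMeasure_mixture ν
  exact integral_bind_of_measurable hM.measurable_translateMeasure f

/-- Integrating the representation of the left translates over `ν`. -/
theorem IsEndomatrix.repr_comp_mobius (hM : IsEndomatrix M) {φ : ℂ → ℂ}
    {ν : Measure (OnePoint ℝ)} (hν : IsReprMeasure φ ν) {z : ℂ} (hz : z ∈ upperHalfPlaneSet) :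
    φ (mobius M z) = ((φ Complex.I).re : ℂ) +
      ((∫ s, (atomic s (mobius M Complex.I)).re ∂ν : ℝ) : ℂ) +
      ∫ t, atomic t z ∂(mixture ν M) := by
  have := hν.finite
  have hmix := hM.integral_mixture ν (atomicMap ⟨z, upperHalfPlaneSet_im_ne_zero hz⟩)
  simp only [atomicMap_apply] at hmix
  have h1 : Integrable (fun s => atomic s (mobius M z)) ν :=
    integrable_continuousMap ν ⟨_, hM.continuous_atomic_mobius hz⟩
  have h2 : Integrable (fun s => ((atomic s (mobius M Complex.I)).re : ℂ)) ν :=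
    integrable_continuousMap ν ⟨_, Complex.continuous_ofReal.comp
      (Complex.continuous_re.comp (hM.continuous_atomic_mobius I_mem_upperHalfPlaneSet))⟩
  simp_rw [hM.integral_atomic_translateMeasure _ hz] at hmix
  rw [integral_sub h1 h2, integral_complex_ofReal] at hmix
  rw [hmix, hν.repr _ (hM.mapsTo hz)]
  ring

/-- At `z = i` the integral over the mixture is purely imaginary, which leaves the real constant
term. -/
theorem IsEndomatrix.re_comp_mobius_I (hM : IsEndomatrix M) {φ : ℂ → ℂ}
    {ν : Measure (OnePoint ℝ)} (hν : IsReprMeasure φ ν) :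
    (φ (mobius M Complex.I)).re =
      (φ Complex.I).re + ∫ s, (atomic s (mobius M Complex.I)).re ∂ν := by
  have h := hM.repr_comp_mobius hν I_mem_upperHalfPlaneSet
  rw [integral_atomic_I] at h
  have h2 := congrArg Complex.re h
  simpa using h2

theorem IsEndomatrix.isReprMeasure_mixture (hM : IsEndomatrix M) {φ : ℂ → ℂ}
    {ν : Measure (OnePoint ℝ)} (hν : IsReprMeasure φ ν) :
    IsReprMeasure (fun z => φ (mobius M z)) (mixture ν M) := by
  have := hν.finite
  refine ⟨hM.isFiniteMeasure_mixture ν, fun z hz => ?_⟩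
  rw [hM.re_comp_mobius_I hν, Complex.ofReal_add]
  exact hM.repr_comp_mobius hν hz

end translate

lemma IsReprMeasure.iff_eq {φ : ℂ → ℂ} {ν : Measure (OnePoint ℝ)} (hν : IsReprMeasure φ ν)
    (μ : Measure (OnePoint ℝ)) : IsReprMeasure φ μ ↔ μ = ν :=
  ⟨fun h => h.unique hν, fun h => h ▸ hν⟩

end MobiusEndo

theorem mainTheorem1 (M : Matrix (Fin 2) (Fin 2) ℂ) (hM : MobiusEndo.IsEndomatrix M)
    (φ : ℂ → ℂ) (hφ : MobiusEndo.IsEndofunction φ)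
    (ν : MeasureTheory.Measure (OnePoint ℝ)) (hν : MobiusEndo.IsReprMeasure φ ν) :
    -- every left translate gives an endofunction, of which `translateMeasure M s` is
    -- the one and only representing measure
    (∀ s : OnePoint ℝ,
      MobiusEndo.IsEndofunction (MobiusEndo.mobius (MobiusEndo.leftTranslate s M)) ∧
      ∀ μ : MeasureTheory.Measure (OnePoint ℝ),
        MobiusEndo.IsReprMeasure (MobiusEndo.mobius (MobiusEndo.leftTranslate s M)) μ ↔
          μ = MobiusEndo.translateMeasure M s) ∧
    -- the mixture is the measure given by the repeated integral of continuous functions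
    (∀ f : C(OnePoint ℝ, ℂ),
      Continuous (fun s : OnePoint ℝ => ∫ t, f t ∂(MobiusEndo.translateMeasure M s)) ∧
      ∫ t, f t ∂(MobiusEndo.mixture ν M) =
        ∫ s, (∫ t, f t ∂(MobiusEndo.translateMeasure M s)) ∂ν) ∧
    -- the representation of the transformed endofunction
    (∀ z ∈ UpperHalfPlane.upperHalfPlaneSet,
      φ (MobiusEndo.mobius M z) =
        ((φ Complex.I).re : ℂ) +
        ((∫ s, (MobiusEndo.atomic s (MobiusEndo.mobius M Complex.I)).re ∂ν : ℝ) : ℂ) +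
        ∫ t, MobiusEndo.atomic t z ∂(MobiusEndo.mixture ν M)) ∧
    -- its real constant term
    (φ (MobiusEndo.mobius M Complex.I)).re =
      (φ Complex.I).re +
        ∫ s, (MobiusEndo.atomic s (MobiusEndo.mobius M Complex.I)).re ∂ν ∧
    -- the mixture is the one and only representing measure of the transformed endofunction
    MobiusEndo.IsEndofunction (fun z => φ (MobiusEndo.mobius M z)) ∧
    ∀ μ : MeasureTheory.Measure (OnePoint ℝ),
      MobiusEndo.IsReprMeasure (fun z => φ (MobiusEndo.mobius M z)) μ ↔
        μ = MobiusEndo.mixture ν M := by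
  have := hν.finite
  exact ⟨fun s => ⟨hM.isEndofunction_leftTranslate s,
      (hM.isReprMeasure_translateMeasure s).iff_eq⟩,
    fun f => ⟨hM.continuous_integral_translateMeasure f, hM.integral_mixture ν f⟩,
    fun z hz => hM.repr_comp_mobius hν hz,
    hM.re_comp_mobius_I hν,
    hφ.comp hM.isEndofunction,
    (hM.isReprMeasure_mixture hν).iff_eq⟩
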